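/- Let $n\ge 1$ and let $f:\mathbb R^n\to\mathbb R$ be convex and differentiable, with a minimizer $x_*$. Assume $|\nabla_i f(x+ue_i)-\nabla_i f(x)|\le L_i|u|$ for all $x\in\mathbb R^n$, $u\in\mathbb R$, $1\le i\le n$, and that $\nabla f$ is $L$-Lipschitz in the Euclidean norm. Let $x_0\in\mathbb R^n$, $R=\|x_0-x_*\|_2$, $H>0$, $Z=\sum_{i=1}^n(H+L_i)$ and $\overline L=\frac1n\sum_{i=1}^nL_i$. The accelerated meta-algorithm with $\widetilde N$ outer and $N$ inner iterations is the following. Put $\lambda=\frac1{2H}$, $A_0=0$, $v_0=x_0$. For $k=0,\dots,\widetilde N-1$ put $a_{k+1}=\frac{\lambda+\sqrt{\lambda^2+4\lambda A_k}}2$, $A_{k+1}=A_k+a_{k+1}$, $\widetilde x_k=\frac{A_kv_k+a_{k+1}x_k}{A_{k+1}}$. Let $v_{k+1}=y_N$, where $y_0=\widetilde x_k$ and $y_{j+1}=y_j-\frac1{H+L_i}\nabla_iF(y_j)\,e_i$ with $F(y)=f(y)+\frac H2\|y-\widetilde x_k\|_2^2$ and with $i$ drawn, independently at every step, with probabilities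 $p_i=(H+L_i)/Z$. Put $x_{k+1}=x_k-a_{k+1}\nabla f(v_{k+1})$. The output is $v_{\widetilde N}$, and the total number of coordinate-descent iterations is $\widetilde N\cdot N$. For $\varepsilon>0$ and $0<\delta<1$ let $$\widetilde N_0=\left\lceil\tfrac{4\sqrt{15}}5\sqrt{\tfrac{HR^2}\varepsilon}\right\rceil,\qquad N_\delta(\widetilde N)=\left\lceil\tfrac ZH\ln\left\{\tfrac{\widetilde N}\delta\left(1+\tfrac LH\right)\left(3+\tfrac{2L}H\right)^2\right\}\right\rceil,\qquad \hat N(H)=\widetilde N_0\cdot N_\delta(\widetilde N_0),$$ where $N_\delta(0)=0$. Then: 1. If $\widetilde N\ge\widetilde N_0$ and $N\ge N_\delta(\widetilde N)$, then $\Pr\big(f(v_{\widetilde N})-f(x_*)<\varepsilon\big)\ge1-\delta$. 2. The corresponding total number of coordinate-descent iterations satisfies $$\hat N(H)=\mathcal O\left(\frac{ZR}{\sqrt H}\cdot\frac1{\varepsilon^{1/2}}\log\left\{\frac1{\varepsilon^{1/2}\delta}\right\}\right)\qquad(\varepsilon\to0),$$ with an absolute constant in $\mathcal O$, for all $0<\delta<1$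 and all $0<\varepsilon<\varepsilon_0$, where $\varepsilon_0>0$ depends only on $H,L,R$. 3. Suppose $\overline L>0$. Up to logarithmic factors the optimal regularization parameter is $H\simeq\overline L$, in the following sense. (a) $H=\overline L$ is the unique minimizer over $H>0$ of the factor $Z/\sqrt H$ in the bound of part 2. (b) For an absolute constant $C$, $\hat N(\overline L)\le C\left(1+\log\left(1+L/\overline L\right)\right)\hat N(H)$ for all $H>0$, $\varepsilon>0$ and $0<\delta<1$. (c) If $R>0$, then for an absolute constant $C$ and for all $0<\delta<1$ and $0<\varepsilon<\varepsilon_0$, where $\varepsilon_0>0$ depends only on $L,\overline L,R$, every $H>0$ with $\hat N(H)\le\hat N(\overline L)$ satisfies $\overline L/C\le H\le C\,\overline L$. -/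

import Mathlib

noncomputable section

/-- Standing assumptions on the objective `f : ℝⁿ → ℝ`: it is differentiable and convex, its `i`-th
partial derivative is Lipschitz along the `i`-th axis with constant `Lc i`, and its gradient is
Lipschitz with constant `L` in the Euclidean norm. -/
structure SmoothConvex {n : ℕ} (f : EuclideanSpace ℝ (Fin n) → ℝ) (L : ℝ) (Lc : Fin n → ℝ) :
    Prop where
  differentiable : Differentiable ℝ f
  convex : ConvexOn ℝ Set.univ f
  coord_lipschitz : ∀ (i : Fin n) (x : EuclideanSpace ℝ (Fin n)) (u : ℝ),
    |gradient f (x + u • EuclideanSpace.single i (1 : ℝ)) i - gradient f x i| ≤ Lc i * |u|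
  grad_lipschitz : ∀ x y : EuclideanSpace ℝ (Fin n),
    ‖gradient f x - gradient f y‖ ≤ L * ‖x - y‖

theorem SmoothConvex.add_pos {n : ℕ} {f : EuclideanSpace ℝ (Fin n) → ℝ} {L : ℝ} {Lc : Fin n → ℝ}
    (hf : SmoothConvex f L Lc) {H : ℝ} (hH : 0 < H) (i : Fin n) : 0 < H + Lc i := by
  have h := (abs_nonneg _).trans (hf.coord_lipschitz i 0 1)
  simp only [abs_one, mul_one] at h
  linarith

/-- `Z = ∑ᵢ (H + Lᵢ)`. -/
def coordSum {n : ℕ} (H : ℝ) (Lc : Fin n → ℝ) : ℝ := ∑ i, (H + Lc i)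

/-- The distribution `π` on the coordinates, with probabilities `pᵢ = (H + Lᵢ) / Z`. -/
def coordPMF {n : ℕ} [NeZero n] (H : ℝ) (Lc : Fin n → ℝ) (hpos : ∀ i, 0 < H + Lc i) :
    PMF (Fin n) :=
  PMF.ofFintype (fun i => ENNReal.ofReal ((H + Lc i) / coordSum H Lc)) (by
    have hZ : 0 < coordSum H Lc := Finset.sum_pos (fun i _ => hpos i) Finset.univ_nonempty
    rw [← ENNReal.ofReal_sum_of_nonneg (fun i _ => (div_pos (hpos i) hZ).le), ← Finset.sum_div]
    change ENNReal.ofReal (coordSum H Lc / coordSum H Lc) = 1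
    rw [div_self hZ.ne', ENNReal.ofReal_one])

/-- The regularized objective `F(y) = f(y) + (H/2) ‖y - c‖²` of the auxiliary problem. -/
def regObj {n : ℕ} (f : EuclideanSpace ℝ (Fin n) → ℝ) (H : ℝ) (c : EuclideanSpace ℝ (Fin n)) :
    EuclideanSpace ℝ (Fin n) → ℝ :=
  fun y => f y + H / 2 * ‖y - c‖ ^ 2

/-- One step of coordinate descent on `F` along the coordinate `i`: only the `i`-th coordinate
changes, `yⁱ ↦ yⁱ - ∇ᵢF(y) / (H + Lᵢ)`. -/
def cdStep {n : ℕ} (F : EuclideanSpace ℝ (Fin n) → ℝ) (H : ℝ) (Lc : Fin n → ℝ)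
    (y : EuclideanSpace ℝ (Fin n)) (i : Fin n) : EuclideanSpace ℝ (Fin n) :=
  y - (1 / (H + Lc i) * gradient F y i) • EuclideanSpace.single i (1 : ℝ)

/-- The law of the point `y_N` produced by `N` iterations of randomized coordinate descent on `F`
from `y₀`, the coordinate being drawn independently from `π` at each iteration. -/
def cdm {n : ℕ} [NeZero n] (F : EuclideanSpace ℝ (Fin n) → ℝ) (H : ℝ) (Lc : Fin n → ℝ)
    (hpos : ∀ i, 0 < H + Lc i) (y₀ : EuclideanSpace ℝ (Fin n)) :
    ℕ → PMF (EuclideanSpace ℝ (Fin n))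
  | 0 => PMF.pure y₀
  | N + 1 => (cdm F H Lc hpos y₀ N).bind fun y =>
      (coordPMF H Lc hpos).map fun i => cdStep F H Lc y i

/-- `a_{k+1} = (λ + √(λ² + 4 λ A_k)) / 2` as a function of `A = A_k`, with `λ = 1 / (2H)`. -/
def amCoeff (H A : ℝ) : ℝ :=
  (1 / (2 * H) + Real.sqrt ((1 / (2 * H)) ^ 2 + 4 * (1 / (2 * H)) * A)) / 2

/-- The sequence `A_0 = 0`, `A_{k+1} = A_k + a_{k+1}`. -/
def amA (H : ℝ) : ℕ → ℝ
  | 0 => 0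
  | k + 1 => amA H k + amCoeff H (amA H k)

/-- `x̃_k = (A_k v_k + a_{k+1} x_k) / A_{k+1}`. -/
def amProx {n : ℕ} (H : ℝ) (k : ℕ) (x v : EuclideanSpace ℝ (Fin n)) :
    EuclideanSpace ℝ (Fin n) :=
  (1 / amA H (k + 1)) • (amA H k • v + amCoeff H (amA H k) • x)

/-- The joint law of `(x_k, v_k)` in the accelerated meta-algorithm started at `x₀`, when the
auxiliary problem with centre `x̃_k` is treated by `N` iterations of coordinate descent from the
point `x̃_k`. -/
def amRun {n : ℕ} [NeZero n] (f : EuclideanSpace ℝ (Fin n) → ℝ) (H : ℝ) (Lc : Fin n → ℝ)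
    (hpos : ∀ i, 0 < H + Lc i) (x₀ : EuclideanSpace ℝ (Fin n)) (N : ℕ) :
    ℕ → PMF (EuclideanSpace ℝ (Fin n) × EuclideanSpace ℝ (Fin n))
  | 0 => PMF.pure (x₀, x₀)
  | k + 1 => (amRun f H Lc hpos x₀ N k).bind fun s =>
      (cdm (regObj f H (amProx H k s.1 s.2)) H Lc hpos (amProx H k s.1 s.2) N).map fun v =>
        (s.1 - amCoeff H (amA H k) • gradient f v, v)

/-- The law of the output `v_M` after `M` outer iterations with `N` inner iterations each. -/
def amOutput {n : ℕ} [NeZero n] (f : EuclideanSpace ℝ (Fin n) → ℝ) (H : ℝ) (Lc : Fin n → ℝ)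
    (hpos : ∀ i, 0 < H + Lc i) (x₀ : EuclideanSpace ℝ (Fin n)) (M N : ℕ) :
    PMF (EuclideanSpace ℝ (Fin n)) :=
  (amRun f H Lc hpos x₀ N M).map Prod.snd

/-- The number of outer iterations, `⌈(4√15/5) √(H R² / ε)⌉`. -/
def numOuter (H R ε : ℝ) : ℕ :=
  ⌈4 * Real.sqrt 15 / 5 * Real.sqrt (H * R ^ 2 / ε)⌉₊

/-- The number of inner iterations per outer iteration,
`⌈(Z/H) ln((M/δ) (1 + L/H) (3 + 2L/H)²)⌉`, when there are `M` outer iterations. -/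
def numInner {n : ℕ} (H L : ℝ) (Lc : Fin n → ℝ) (δ : ℝ) (M : ℕ) : ℕ :=
  ⌈coordSum H Lc / H * Real.log (M / δ * (1 + L / H) * (3 + 2 * L / H) ^ 2)⌉₊

/-- The total number of coordinate-descent iterations, (outer iterations) × (inner iterations). -/
def numTotal {n : ℕ} (H L : ℝ) (Lc : Fin n → ℝ) (R ε δ : ℝ) : ℕ :=
  numOuter H R ε * numInner H L Lc δ (numOuter H R ε)

/-- The mean `(1/n) ∑ᵢ Lᵢ`. -/
def meanLip {n : ℕ} (Lc : Fin n → ℝ) : ℝ := 1 / (n : ℝ) * ∑ i, Lc i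

end

open scoped InnerProductSpace ENNReal

/-! Correctness. Write F for the regularized objective with centre c. If the inner point v satisfies
the relative-error criterion ‖∇F(v)‖ ≤ H‖v - c‖, one outer step does not increase A_k (f(v_k) -
f(x_*)) + ‖x_k - x_*‖²/2 (`SmoothConvex.lyapunov_step`). Since A_k ≥ k²/(8H), M such steps leave a
gap of at most 4HR²/M². The criterion is reached because F is H-strongly convex: a coordinate step
contracts the expected gap of F by 1 - H/Z (`SmoothConvex.lexp_cdStep_le`). The initial gap and the
gap that suffices for the criterion are both multiples of the squared distance from c to the
minimizer of F, so this unknown distance cancels. Markov's inequality then bounds the failure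
probability of one outer step by δ/M, and a union bound gives δ.

Complexity. Let l be the mean of the Lᵢ. As Z/H = n(1 + l/H) and the outer count is a ceiling
proportional to √H, the total behaves like (H + l)/√H times a logarithm, and AM-GM singles out H =
l. The comparisons of totals must also control the ceilings and the logarithms, which depend on H;
the inner count is bounded on both sides (`numInner_le`, `le_numInner`) and the outer counts are
compared by `numOuter_le_mul`. -/

/-- A one-dimensional descent inequality. -/
theorem le_add_of_deriv_sub_le {φ φ' : ℝ → ℝ} {K : ℝ} (hφ : ∀ t, HasDerivAt φ (φ' t) t)
    (hK : ∀ t, 0 ≤ t → φ' t - φ' 0 ≤ K * t) : φ 1 ≤ φ 0 + φ' 0 + K / 2 := by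
  have hd : ∀ t, HasDerivAt (fun t => φ t - φ' 0 * t - K / 2 * t ^ 2)
      (φ' t - φ' 0 - K * t) t := fun t => by
    have h := ((hφ t).sub ((hasDerivAt_id t).const_mul (φ' 0))).sub
      (((hasDerivAt_id t).pow 2).const_mul (K / 2))
    refine h.congr_deriv ?_
    simp
    ring
  have hanti : AntitoneOn (fun t => φ t - φ' 0 * t - K / 2 * t ^ 2) (Set.Icc 0 1) := by
    refine antitoneOn_of_deriv_nonpos (convex_Icc 0 1)
      (fun t _ => (hd t).continuousAt.continuousWithinAt)
      (fun t _ => (hd t).differentiableAt.differentiableWithinAt) fun t ht => ?_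
    rw [interior_Icc] at ht
    rw [(hd t).deriv]
    linarith [hK t ht.1.le]
  have h := hanti (Set.left_mem_Icc.2 zero_le_one) (Set.right_mem_Icc.2 zero_le_one) zero_le_one
  norm_num at h
  linarith

/-! ### Calculus along lines: descent and first-order convexity. -/

section Gradient

variable {E : Type*} [NormedAddCommGroup E] [InnerProductSpace ℝ E] [CompleteSpace E]

theorem hasDerivAt_comp_line {F : E → ℝ} (hF : Differentiable ℝ F) (x h : E) (t : ℝ) :
    HasDerivAt (fun t : ℝ => F (x + t • h)) ⟪gradient F (x + t • h), h⟫_ℝ t := by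
  rw [inner_gradient_left]
  refine (hF (x + t • h)).hasFDerivAt.comp_hasDerivAt t ?_
  simpa using ((hasDerivAt_id t).smul_const h).const_add x

/-- The descent lemma in a given direction. -/
theorem le_add_inner_gradient_of_le {F : E → ℝ} (hF : Differentiable ℝ F) {x h : E} {K : ℝ}
    (hK : ∀ t : ℝ, 0 ≤ t → ⟪gradient F (x + t • h) - gradient F x, h⟫_ℝ ≤ K * t) :
    F (x + h) ≤ F x + ⟪gradient F x, h⟫_ℝ + K / 2 := by
  have := le_add_of_deriv_sub_le (K := K) (hasDerivAt_comp_line hF x h) fun t ht => by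
    simpa [inner_sub_left] using hK t ht
  simpa using this

theorem ConvexOn.add_inner_gradient_le {f : E → ℝ} (hc : ConvexOn ℝ Set.univ f)
    (hf : Differentiable ℝ f) (x y : E) : f x + ⟪gradient f x, y - x⟫_ℝ ≤ f y := by
  have hconv : ConvexOn ℝ Set.univ (fun t : ℝ => f (x + t • (y - x))) := by
    refine ⟨convex_univ, fun s _ t _ a b ha hb hab => ?_⟩
    have h := hc.2 (Set.mem_univ (x + s • (y - x))) (Set.mem_univ (x + t • (y - x))) ha hb hab
    convert h using 2
    have : x = (a + b) • x := by rw [hab, one_smul]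
    nth_rewrite 1 [this]
    simp only [smul_eq_mul]
    module
  have hd := hasDerivAt_comp_line hf x (y - x) 0
  have h := hconv.le_slope_of_hasDerivAt (Set.mem_univ 0) (Set.mem_univ 1) zero_lt_one hd
  rw [slope_def_field] at h
  simp only [zero_smul, one_smul, add_zero, sub_zero, div_one, add_sub_cancel] at h
  linarith

theorem gradient_eq_zero_of_forall_le {f : E → ℝ} {x : E} (h : ∀ y, f x ≤ f y) :
    gradient f x = 0 := by
  have : IsLocalMin f x := Filter.Eventually.of_forall h
  simp [gradient, this.fderiv_eq_zero]

end Gradient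

/-! ### The regularized objective: strong convexity, smoothness, coordinate steps. -/

section RegObj

variable {n : ℕ} {f : EuclideanSpace ℝ (Fin n) → ℝ} {L : ℝ} {Lc : Fin n → ℝ} {H : ℝ}
  {c : EuclideanSpace ℝ (Fin n)}

theorem SmoothConvex.coord_nonneg (hf : SmoothConvex f L Lc) (i : Fin n) : 0 ≤ Lc i := by
  simpa using (abs_nonneg _).trans (hf.coord_lipschitz i 0 1)

theorem hasGradientAt_regObj (hf : Differentiable ℝ f) (y : EuclideanSpace ℝ (Fin n)) :
    HasGradientAt (regObj f H c) (gradient f y + H • (y - c)) y := by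
  rw [hasGradientAt_iff_hasFDerivAt]
  have h1 := (hf y).hasFDerivAt
  have h2 : HasFDerivAt (fun y => ‖y - c‖ ^ 2) _ y := ((hasFDerivAt_id y).sub_const c).norm_sq
  refine (h1.add (h2.const_mul (H / 2))).congr_fderiv ?_
  ext z
  simp
  ring

theorem gradient_regObj (hf : Differentiable ℝ f) (y : EuclideanSpace ℝ (Fin n)) :
    gradient (regObj f H c) y = gradient f y + H • (y - c) :=
  (hasGradientAt_regObj hf y).gradient

theorem differentiable_regObj (hf : Differentiable ℝ f) : Differentiable ℝ (regObj f H c) :=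
  fun y => (hasGradientAt_regObj hf y).differentiableAt

/-- The quadratic term has an exact second-order expansion, which is added to the first-order
convexity inequality of f. -/
theorem SmoothConvex.strong_convexity (hf : SmoothConvex f L Lc)
    (x y : EuclideanSpace ℝ (Fin n)) :
    regObj f H c x + ⟪gradient (regObj f H c) x, y - x⟫_ℝ + H / 2 * ‖y - x‖ ^ 2 ≤
      regObj f H c y := by
  have h := hf.convex.add_inner_gradient_le hf.differentiable x y
  have h2 : ‖y - c‖ ^ 2 = ‖x - c‖ ^ 2 + 2 * ⟪x - c, y - x⟫_ℝ + ‖y - x‖ ^ 2 := by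
    rw [← norm_add_sq_real]; congr 2; abel
  rw [gradient_regObj hf.differentiable, inner_add_left, real_inner_smul_left]
  simp only [regObj]
  rw [h2]
  linarith

/-- A lower bound on f makes the regularized objective coercive. -/
theorem SmoothConvex.exists_minimizer (hf : SmoothConvex f L Lc) (hH : 0 < H)
    {xs : EuclideanSpace ℝ (Fin n)} (hxs : ∀ y, f xs ≤ f y) :
    ∃ ys, ∀ y, regObj f H c ys ≤ regObj f H c y := by
  refine (differentiable_regObj hf.differentiable).continuous.exists_forall_le ?_
  have h1 : Filter.Tendsto (fun y => ‖y - c‖) (Filter.cocompact _) Filter.atTop := by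
    have := (tendsto_norm_cocompact_atTop (E := EuclideanSpace ℝ (Fin n))).comp
      (Homeomorph.subRight c).isClosedEmbedding.tendsto_cocompact
    exact this
  have h2 := ((Filter.tendsto_pow_atTop two_ne_zero).comp h1).const_mul_atTop (half_pos hH)
  exact Filter.tendsto_atTop_mono (fun y => add_le_add (hxs y) le_rfl)
    (Filter.tendsto_atTop_add_const_left _ (f xs) h2)

/-- The Polyak–Łojasiewicz inequality, by completing the square in the strong convexity bound. -/
theorem SmoothConvex.sub_min_le (hf : SmoothConvex f L Lc) (hH : 0 < H)
    (x y : EuclideanSpace ℝ (Fin n)) :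
    2 * H * (regObj f H c x - regObj f H c y) ≤ ‖gradient (regObj f H c) x‖ ^ 2 := by
  have h := hf.strong_convexity (H := H) (c := c) x y
  have h2 := sq_nonneg ‖gradient (regObj f H c) x + H • (y - x)‖
  have h3 : ‖gradient (regObj f H c) x + H • (y - x)‖ ^ 2 = ‖gradient (regObj f H c) x‖ ^ 2 +
      2 * (H * ⟪gradient (regObj f H c) x, y - x⟫_ℝ) + H ^ 2 * ‖y - x‖ ^ 2 := by
    rw [norm_add_sq_real, real_inner_smul_right, norm_smul, mul_pow, Real.norm_eq_abs, sq_abs]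
  nlinarith

theorem SmoothConvex.norm_gradient_regObj_sub_le (hf : SmoothConvex f L Lc) (hH : 0 < H)
    (x y : EuclideanSpace ℝ (Fin n)) :
    ‖gradient (regObj f H c) x - gradient (regObj f H c) y‖ ≤ (L + H) * ‖x - y‖ := by
  rw [gradient_regObj hf.differentiable, gradient_regObj hf.differentiable]
  have : gradient f x + H • (x - c) - (gradient f y + H • (y - c)) =
      gradient f x - gradient f y + H • (x - y) := by module
  rw [this]
  refine (norm_add_le _ _).trans ?_
  rw [norm_smul, Real.norm_of_nonneg hH.le, add_mul]
  gcongr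
  exact hf.grad_lipschitz x y

theorem SmoothConvex.regObj_sub_le (hf : SmoothConvex f L Lc) (hH : 0 < H)
    {ys : EuclideanSpace ℝ (Fin n)} (hys : ∀ y, regObj f H c ys ≤ regObj f H c y)
    (y : EuclideanSpace ℝ (Fin n)) :
    regObj f H c y - regObj f H c ys ≤ (L + H) / 2 * ‖y - ys‖ ^ 2 := by
  have h := le_add_inner_gradient_of_le (differentiable_regObj hf.differentiable)
    (F := regObj f H c) (x := ys) (h := y - ys) (K := (L + H) * ‖y - ys‖ ^ 2) fun t ht => by
      refine (real_inner_le_norm _ _).trans ?_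
      have := hf.norm_gradient_regObj_sub_le (c := c) hH (ys + t • (y - ys)) ys
      rw [add_sub_cancel_left, norm_smul, Real.norm_of_nonneg ht] at this
      calc _ ≤ (L + H) * (t * ‖y - ys‖) * ‖y - ys‖ := by gcongr
        _ = _ := by ring
  rw [gradient_eq_zero_of_forall_le hys, inner_zero_left, add_sub_cancel] at h
  linarith

/-- One coordinate-descent step decreases the regularized objective. -/
theorem SmoothConvex.regObj_cdStep_le (hf : SmoothConvex f L Lc) (hH : 0 < H)
    (y : EuclideanSpace ℝ (Fin n)) (i : Fin n) :
    regObj f H c (cdStep (regObj f H c) H Lc y i) ≤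
      regObj f H c y - 1 / (2 * (H + Lc i)) * gradient (regObj f H c) y i ^ 2 := by
  have hpos := hf.add_pos hH i
  set g := gradient (regObj f H c) y i with hg
  set s := -(1 / (H + Lc i) * g) with hs
  have hstep : cdStep (regObj f H c) H Lc y i = y + s • EuclideanSpace.single i (1 : ℝ) := by
    rw [cdStep, hs, neg_smul, sub_eq_add_neg]
  have h := le_add_inner_gradient_of_le (differentiable_regObj hf.differentiable)
    (F := regObj f H c) (x := y) (h := s • EuclideanSpace.single i (1 : ℝ))
    (K := (H + Lc i) * s ^ 2) fun t ht => by
      rw [real_inner_smul_right, EuclideanSpace.inner_single_right, smul_smul,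
        gradient_regObj hf.differentiable, gradient_regObj hf.differentiable]
      have h1 := hf.coord_lipschitz i y (t * s)
      simp only [PiLp.sub_apply, PiLp.add_apply, PiLp.smul_apply, PiLp.single_apply,
        if_true, smul_eq_mul, mul_one, one_mul, conj_trivial]
      have h2 : s * (gradient f (y + (t * s) • EuclideanSpace.single i 1) i - gradient f y i) ≤
          Lc i * (t * s ^ 2) := by
        refine (le_abs_self _).trans ?_
        rw [abs_mul]
        calc _ ≤ |s| * (Lc i * |t * s|) := by gcongr
          _ = Lc i * (t * |s| ^ 2) := by rw [abs_mul, abs_of_nonneg ht]; ring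
          _ = _ := by rw [sq_abs]
      linarith
  rw [← hstep, real_inner_smul_right, EuclideanSpace.inner_single_right] at h
  simp only [one_mul, conj_trivial, ← hg] at h
  refine h.trans (le_of_eq ?_)
  rw [hs]
  field_simp
  ring

end RegObj

/-! ### Expectations, Markov's inequality and a union bound for discrete laws. -/

namespace PMF

variable {α β : Type*}

/-- The expectation of an extended nonnegative function under a probability mass function. -/
noncomputable def lexp (p : PMF α) (g : α → ℝ≥0∞) : ℝ≥0∞ := ∑' a, p a * g a

theorem lexp_pure (a : α) (g : α → ℝ≥0∞) : (pure a).lexp g = g a := by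
  rw [lexp, tsum_eq_single a]
  · simp
  · intro b hb
    rw [pure_apply_of_ne _ _ hb, zero_mul]

theorem lexp_bind (p : PMF α) (q : α → PMF β) (g : β → ℝ≥0∞) :
    (p.bind q).lexp g = p.lexp fun a => (q a).lexp g := by
  simp only [lexp, bind_apply, ← ENNReal.tsum_mul_right, ← ENNReal.tsum_mul_left]
  rw [ENNReal.tsum_comm]
  simp only [mul_assoc]

theorem lexp_map (p : PMF α) (h : α → β) (g : β → ℝ≥0∞) :
    (p.map h).lexp g = p.lexp fun a => g (h a) := by
  rw [map, lexp_bind]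
  simp only [Function.comp, lexp_pure]

theorem lexp_mono (p : PMF α) {g h : α → ℝ≥0∞} (hgh : ∀ a, g a ≤ h a) : p.lexp g ≤ p.lexp h :=
  ENNReal.tsum_le_tsum fun a => by gcongr; exact hgh a

theorem lexp_const_mul (p : PMF α) (c : ℝ≥0∞) (g : α → ℝ≥0∞) :
    (p.lexp fun a => c * g a) = c * p.lexp g := by
  simp only [lexp, ← ENNReal.tsum_mul_left, mul_left_comm]

theorem lexp_const (p : PMF α) (c : ℝ≥0∞) : (p.lexp fun _ => c) = c := by
  rw [lexp, ENNReal.tsum_mul_right, tsum_coe, one_mul]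

theorem lexp_indicator_one (p : PMF α) (s : Set α) :
    p.lexp (s.indicator 1) = p.toOuterMeasure s := by
  rw [lexp, toOuterMeasure_apply]
  refine tsum_congr fun a => ?_
  by_cases h : a ∈ s <;> simp [h]

theorem toOuterMeasure_le_one (p : PMF α) (s : Set α) : p.toOuterMeasure s ≤ 1 := by
  rw [← lexp_indicator_one]
  refine (p.lexp_mono (h := fun _ => 1) fun a => ?_).trans_eq (p.lexp_const 1)
  exact Set.indicator_apply_le fun _ => le_rfl

theorem toOuterMeasure_compl_add (p : PMF α) (s : Set α) :
    p.toOuterMeasure s + p.toOuterMeasure sᶜ = 1 := by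
  rw [toOuterMeasure_apply, toOuterMeasure_apply, ← ENNReal.tsum_add, ← p.tsum_coe]
  refine tsum_congr fun a => ?_
  by_cases h : a ∈ s <;> simp [h]

/-- Markov's inequality, in a form that also covers the threshold `0`. -/
theorem toOuterMeasure_le_of_lexp_le (p : PMF α) {g : α → ℝ≥0∞} {c η : ℝ≥0∞} (hc : c ≠ ∞)
    (hg : p.lexp g ≤ η * c) {s : Set α} (hs : ∀ a ∈ s, c < g a) : p.toOuterMeasure s ≤ η := by
  rcases eq_or_ne c 0 with rfl | h0
  · have h : p.toOuterMeasure s = 0 := by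
      rw [mul_zero, nonpos_iff_eq_zero, lexp, ENNReal.tsum_eq_zero] at hg
      rw [toOuterMeasure_apply, ENNReal.tsum_eq_zero]
      intro a
      by_cases ha : a ∈ s
      · simpa [ha, (hs a ha).ne'] using hg a
      · simp [ha]
    simp [h]
  · rw [← ENNReal.mul_le_mul_iff_left h0 hc]
    refine le_trans ?_ hg
    rw [mul_comm, ← lexp_indicator_one, ← lexp_const_mul]
    refine p.lexp_mono fun a => ?_
    by_cases ha : a ∈ s
    · simpa [ha] using (hs a ha).le
    · simp [ha]

/-- If the inner law is bad with probability at most `η` whatever the outer sample, then the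
composed law is bad with probability at most `η` more than the outer one. -/
theorem toOuterMeasure_bind_le (p : PMF α) (q : α → PMF β) {s : Set α} {t : Set β} {η : ℝ≥0∞}
    (h : ∀ a ∉ s, (q a).toOuterMeasure t ≤ η) :
    (p.bind q).toOuterMeasure t ≤ p.toOuterMeasure s + η := by
  rw [← lexp_indicator_one, lexp_bind]
  simp only [lexp_indicator_one]
  calc _ ≤ p.lexp (fun a => s.indicator 1 a + η) := p.lexp_mono fun a => by
        by_cases ha : a ∈ s
        · simpa [ha] using le_add_right ((q a).toOuterMeasure_le_one t)
        · simpa [ha] using h a ha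
    _ = p.lexp (s.indicator 1) + p.lexp (fun _ => η) := by
        simp only [lexp, mul_add, ENNReal.tsum_add]
    _ = _ := by rw [lexp_indicator_one, lexp_const]

end PMF

/-! ### Convergence of the inner loop. -/

section CoordinateDescent

variable {n : ℕ} [NeZero n] {f : EuclideanSpace ℝ (Fin n) → ℝ} {L : ℝ} {Lc : Fin n → ℝ} {H : ℝ}
  {c : EuclideanSpace ℝ (Fin n)}

theorem SmoothConvex.nonneg (hf : SmoothConvex f L Lc) : 0 ≤ L := by
  have h := (norm_nonneg _).trans (hf.grad_lipschitz (EuclideanSpace.single 0 1) 0)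
  simpa using h

theorem le_coordSum (hLc : ∀ i, 0 ≤ Lc i) (hH : 0 < H) : H ≤ coordSum H Lc :=
  (le_add_of_nonneg_right (hLc 0)).trans
    (Finset.single_le_sum (f := fun i => H + Lc i) (fun i _ => add_nonneg hH.le (hLc i))
      (Finset.mem_univ 0))

/-- Coordinate i is drawn with weight H + Lᵢ and decreases F by (∇ᵢF)²/(2(H + Lᵢ)). The weights
cancel, the mean decrease is ‖∇F‖²/(2Z), and the Polyak–Łojasiewicz inequality bounds it below by
H/Z times the gap. -/
theorem SmoothConvex.lexp_cdStep_le (hf : SmoothConvex f L Lc) (hH : 0 < H)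
    {ys : EuclideanSpace ℝ (Fin n)} (hys : ∀ y, regObj f H c ys ≤ regObj f H c y)
    (y : EuclideanSpace ℝ (Fin n)) :
    ((coordPMF H Lc fun i => hf.add_pos hH i).lexp fun i => ENNReal.ofReal
      (regObj f H c (cdStep (regObj f H c) H Lc y i) - regObj f H c ys)) ≤
    ENNReal.ofReal (1 - H / coordSum H Lc) *
      ENNReal.ofReal (regObj f H c y - regObj f H c ys) := by
  have hpos := fun i => hf.add_pos hH i
  have hHZ := le_coordSum hf.coord_nonneg hH
  have hZ := hH.trans_le hHZ
  have hZ1 : 0 ≤ 1 - H / coordSum H Lc := sub_nonneg.2 ((div_le_one hZ).2 hHZ)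
  rw [PMF.lexp, tsum_fintype, ← ENNReal.ofReal_mul hZ1]
  simp only [coordPMF, PMF.ofFintype_apply, ← ENNReal.ofReal_mul (div_pos (hpos _) hZ).le]
  rw [← ENNReal.ofReal_sum_of_nonneg fun i _ =>
    mul_nonneg (div_pos (hpos i) hZ).le (sub_nonneg.2 (hys _))]
  refine ENNReal.ofReal_le_ofReal ?_
  calc _ ≤ ∑ i, (H + Lc i) / coordSum H Lc * (regObj f H c y -
          1 / (2 * (H + Lc i)) * gradient (regObj f H c) y i ^ 2 - regObj f H c ys) := by
        gcongr with i
        · exact (div_pos (hpos i) hZ).le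
        · exact hf.regObj_cdStep_le hH y i
    _ = ∑ i, ((H + Lc i) * ((regObj f H c y - regObj f H c ys) / coordSum H Lc) -
          gradient (regObj f H c) y i ^ 2 * (1 / (2 * coordSum H Lc))) := by
        refine Finset.sum_congr rfl fun i _ => ?_
        have := (hpos i).ne'
        field_simp
        ring
    _ = (regObj f H c y - regObj f H c ys) -
          ‖gradient (regObj f H c) y‖ ^ 2 * (1 / (2 * coordSum H Lc)) := by
        rw [Finset.sum_sub_distrib, ← Finset.sum_mul, ← Finset.sum_mul,
          EuclideanSpace.real_norm_sq_eq]
        change coordSum H Lc * _ - _ = _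
        rw [mul_div_cancel₀ _ hZ.ne']
    _ ≤ (regObj f H c y - regObj f H c ys) -
          2 * H * (regObj f H c y - regObj f H c ys) * (1 / (2 * coordSum H Lc)) := by
        gcongr
        exact hf.sub_min_le hH y ys
    _ = _ := by
        field_simp

/-- Linear convergence in expectation of randomized coordinate descent. -/
theorem SmoothConvex.lexp_cdm_le (hf : SmoothConvex f L Lc) (hH : 0 < H)
    {ys : EuclideanSpace ℝ (Fin n)} (hys : ∀ y, regObj f H c ys ≤ regObj f H c y)
    (y₀ : EuclideanSpace ℝ (Fin n)) (N : ℕ) :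
    ((cdm (regObj f H c) H Lc (fun i => hf.add_pos hH i) y₀ N).lexp fun y =>
      ENNReal.ofReal (regObj f H c y - regObj f H c ys)) ≤
    ENNReal.ofReal (1 - H / coordSum H Lc) ^ N *
      ENNReal.ofReal (regObj f H c y₀ - regObj f H c ys) := by
  induction N with
  | zero => rw [cdm, PMF.lexp_pure, pow_zero, one_mul]
  | succ N ih =>
    rw [cdm, PMF.lexp_bind]
    simp only [PMF.lexp_map]
    refine (PMF.lexp_mono _ fun y => hf.lexp_cdStep_le hH hys y).trans ?_
    rw [PMF.lexp_const_mul, pow_succ', mul_assoc]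
    gcongr

/-- A point whose objective gap is small relative to the distance from the centre to the minimizer
satisfies the relative-error criterion. -/
theorem SmoothConvex.norm_gradient_le_of_gap_le (hf : SmoothConvex f L Lc) (hH : 0 < H)
    {ys : EuclideanSpace ℝ (Fin n)} (hys : ∀ y, regObj f H c ys ≤ regObj f H c y)
    {v : EuclideanSpace ℝ (Fin n)}
    (hv : regObj f H c v - regObj f H c ys ≤ H / 2 * (H / (L + 2 * H) * ‖c - ys‖) ^ 2) :
    ‖gradient (regObj f H c) v‖ ≤ H * ‖v - c‖ := by
  have hL := hf.nonneg
  have h0 := gradient_eq_zero_of_forall_le hys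
  have h1 := hf.strong_convexity (H := H) (c := c) ys v
  rw [h0, inner_zero_left, add_zero] at h1
  -- The denominator is L + 2H because one H is lost to the triangle inequality in `h4`, which
  -- leaves the smoothness constant L + H of F.
  have h2 : ‖v - ys‖ ≤ H / (L + 2 * H) * ‖c - ys‖ := by
    refine le_of_sq_le_sq ?_ (by positivity)
    exact le_of_mul_le_mul_left (by linarith) (half_pos hH)
  have h3 := hf.norm_gradient_regObj_sub_le (c := c) hH v ys
  rw [h0, sub_zero] at h3
  have h4 : ‖c - ys‖ ≤ ‖v - c‖ + ‖v - ys‖ := by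
    rw [norm_sub_rev v c]
    exact norm_sub_le_norm_sub_add_norm_sub c v ys
  have h5 : (L + 2 * H) * ‖v - ys‖ ≤ H * ‖c - ys‖ := by
    calc _ ≤ (L + 2 * H) * (H / (L + 2 * H) * ‖c - ys‖) := by gcongr
      _ = _ := by field_simp
  nlinarith

/-- Enough coordinate-descent iterations produce a point satisfying the relative-error criterion
with high probability. -/
theorem SmoothConvex.toOuterMeasure_cdm_le (hf : SmoothConvex f L Lc) (hH : 0 < H)
    {xs : EuclideanSpace ℝ (Fin n)} (hxs : ∀ y, f xs ≤ f y) {δ : ℝ} (hδ : 0 < δ) {M N : ℕ}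
    (hM : 0 < M) (hN : numInner H L Lc δ M ≤ N) :
    (cdm (regObj f H c) H Lc (fun i => hf.add_pos hH i) c N).toOuterMeasure
      {v | ¬ ‖gradient (regObj f H c) v‖ ≤ H * ‖v - c‖} ≤ ENNReal.ofReal (δ / M) := by
  obtain ⟨ys, hys⟩ := hf.exists_minimizer (c := c) hH hxs
  have hL := hf.nonneg
  have hHZ := le_coordSum hf.coord_nonneg hH
  have hZ := hH.trans_le hHZ
  have hZ1 : 0 ≤ 1 - H / coordSum H Lc := sub_nonneg.2 ((div_le_one hZ).2 hHZ)
  have hM' : (0 : ℝ) < M := by exact_mod_cast hM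
  -- The threshold is zero when the centre already minimizes F, hence the need for a Markov
  -- inequality valid there.
  refine PMF.toOuterMeasure_le_of_lexp_le _
    (c := ENNReal.ofReal (H / 2 * (H / (L + 2 * H) * ‖c - ys‖) ^ 2)) ENNReal.ofReal_ne_top
    ((hf.lexp_cdm_le hH hys c N).trans ?_) fun v hv => ?_
  · rw [← ENNReal.ofReal_pow hZ1, ← ENNReal.ofReal_mul (pow_nonneg hZ1 _),
      ← ENNReal.ofReal_mul (div_pos hδ hM').le]
    refine ENNReal.ofReal_le_ofReal ?_
    set K := (1 + L / H) * (3 + 2 * L / H) ^ 2 with hK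
    have hKpos : 0 < K := by positivity
    have hrate : (1 - H / coordSum H Lc) ^ N ≤ 1 / (M / δ * K) := by
      have h1 : (1 - H / coordSum H Lc) ^ N ≤ Real.exp (-(H / coordSum H Lc)) ^ N :=
        pow_le_pow_left₀ hZ1 (Real.one_sub_le_exp_neg _) N
      refine h1.trans ?_
      rw [← Real.exp_nat_mul, one_div, ← Real.exp_log (show 0 < M / δ * K by positivity),
        ← Real.exp_neg, Real.exp_le_exp]
      have h2 : coordSum H Lc / H * Real.log (M / δ * K) ≤ N := by
        rw [hK, ← mul_assoc]
        exact (Nat.le_ceil _).trans (by exact_mod_cast hN)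
      rw [mul_neg, neg_le_neg_iff]
      calc _ = coordSum H Lc / H * Real.log (M / δ * K) * (H / coordSum H Lc) := by
            field_simp
        _ ≤ _ := by gcongr
    have hgap := hf.regObj_sub_le hH hys c
    calc _ ≤ 1 / (M / δ * K) * ((L + H) / 2 * ‖c - ys‖ ^ 2) :=
          mul_le_mul hrate hgap (sub_nonneg.2 (hys c)) (by positivity)
      -- In K, the factor 1 + L/H turns the smoothness constant L + H into H, and the square
      -- produces (H/(3H + 2L))², slightly more than the required (H/(L + 2H))².
      _ = δ / M * (H / 2 * (H / (3 * H + 2 * L) * ‖c - ys‖) ^ 2) := by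
          rw [hK]
          field_simp
          ring
      _ ≤ _ := by
          gcongr δ / M * (H / 2 * (H / ?_ * ‖c - ys‖) ^ 2)
          linarith
  · by_contra hlt
    refine hv (hf.norm_gradient_le_of_gap_le hH hys ?_)
    rw [not_lt] at hlt
    exact (ENNReal.ofReal_le_ofReal_iff (by positivity)).1 hlt

end CoordinateDescent

/-! ### The outer loop: growth of A_k, Lyapunov function, success probability. -/

section Acceleration

variable {H : ℝ}

theorem amCoeff_sq (hH : 0 < H) {A : ℝ} (hA : 0 ≤ A) :
    amCoeff H A ^ 2 = 1 / (2 * H) * (A + amCoeff H A) := by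
  have h := Real.sq_sqrt (show 0 ≤ (1 / (2 * H)) ^ 2 + 4 * (1 / (2 * H)) * A by positivity)
  rw [amCoeff]
  linear_combination h / 4

theorem amCoeff_pos (hH : 0 < H) (A : ℝ) : 0 < amCoeff H A := by
  rw [amCoeff]
  positivity

/-- Dropping λ² under the root and using induction, the increment is at least (k + 1)/(4H), while (k
+ 1)² - k² only requires (2k + 1)/(8H). -/
theorem le_amA (hH : 0 < H) (k : ℕ) : (k : ℝ) ^ 2 / (8 * H) ≤ amA H k := by
  induction k with
  | zero => simp [amA]
  | succ k ih =>
    have h : 1 / (2 * H) * k ≤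
        Real.sqrt ((1 / (2 * H)) ^ 2 + 4 * (1 / (2 * H)) * amA H k) := by
      refine Real.le_sqrt_of_sq_le ?_
      calc (1 / (2 * H) * k) ^ 2 = 4 * (1 / (2 * H)) * ((k : ℝ) ^ 2 / (8 * H)) := by
            field_simp
            ring
        _ ≤ 4 * (1 / (2 * H)) * amA H k := by gcongr
        _ ≤ _ := le_add_of_nonneg_left (by positivity)
    rw [amA, amCoeff]
    have h2 : ((k + 1 : ℕ) : ℝ) ^ 2 / (8 * H) + 1 / (8 * H) =
        (k : ℝ) ^ 2 / (8 * H) + (1 / (2 * H) + 1 / (2 * H) * k) / 2 := by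
      push_cast
      field_simp
      ring
    have h3 : 0 < 1 / (8 * H) := by positivity
    linarith

theorem amA_nonneg (hH : 0 < H) (k : ℕ) : 0 ≤ amA H k :=
  le_trans (by positivity) (le_amA hH k)

/-- One outer iteration does not increase the Lyapunov function, if the auxiliary problem is solved
up to the relative-error criterion. -/
theorem SmoothConvex.lyapunov_step {n : ℕ} {f : EuclideanSpace ℝ (Fin n) → ℝ} {L : ℝ}
    {Lc : Fin n → ℝ} (hf : SmoothConvex f L Lc) (hH : 0 < H) (k : ℕ)
    (xs x v w : EuclideanSpace ℝ (Fin n))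
    (hw : ‖gradient (regObj f H (amProx H k x v)) w‖ ≤ H * ‖w - amProx H k x v‖) :
    amA H (k + 1) * (f w - f xs) +
        1 / 2 * ‖x - amCoeff H (amA H k) • gradient f w - xs‖ ^ 2 ≤
      amA H k * (f v - f xs) + 1 / 2 * ‖x - xs‖ ^ 2 := by
  have hA := amA_nonneg hH k
  have hsq := amCoeff_sq hH hA
  have ha := amCoeff_pos hH (amA H k)
  have hA1 : amA H (k + 1) = amA H k + amCoeff H (amA H k) := rfl
  have hprox : amA H (k + 1) • amProx H k x v = amA H k • v + amCoeff H (amA H k) • x := by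
    rw [amProx, smul_smul, mul_one_div_cancel (by rw [hA1]; positivity), one_smul]
  rw [gradient_regObj hf.differentiable] at hw
  set a := amCoeff H (amA H k)
  set A := amA H k
  set g := gradient f w
  set z := amProx H k x v
  have h1 := hf.convex.add_inner_gradient_le hf.differentiable w v
  have h2 := hf.convex.add_inner_gradient_le hf.differentiable w xs
  have h3 : ‖x - a • g - xs‖ ^ 2 = ‖x - xs‖ ^ 2 - 2 * (a * ⟪g, x - xs⟫_ℝ) + a ^ 2 * ‖g‖ ^ 2 := by
    rw [sub_right_comm, norm_sub_sq_real, real_inner_smul_right, norm_smul, mul_pow,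
      Real.norm_eq_abs, sq_abs, real_inner_comm]
  -- Squaring the criterion cancels H²‖w - z‖²; half of the remaining ‖g‖² suffices, since a² = (A +
  -- a)/(2H) turns it into the a²‖g‖²/2 of `h9`.
  have h4 : 2 * H * ⟪g, w - z⟫_ℝ + ‖g‖ ^ 2 / 2 ≤ 0 := by
    have h5 : ‖g + H • (w - z)‖ ^ 2 ≤ (H * ‖w - z‖) ^ 2 := by gcongr
    rw [norm_add_sq_real, real_inner_smul_right, norm_smul, Real.norm_of_nonneg hH.le] at h5
    linarith [sq_nonneg ‖g‖]
  have h6 : A * ⟪g, v - w⟫_ℝ + a * ⟪g, xs - w⟫_ℝ =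
      -((A + a) * ⟪g, w - z⟫_ℝ) - a * ⟪g, x - xs⟫_ℝ := by
    rw [← real_inner_smul_right, ← real_inner_smul_right, ← real_inner_smul_right,
      ← real_inner_smul_right, ← inner_add_right, ← inner_neg_right, ← inner_sub_right]
    congr 1
    rw [hA1] at hprox
    rw [smul_sub (A + a), hprox]
    module
  have h7 := mul_le_mul_of_nonneg_left h1 hA
  have h8 := mul_le_mul_of_nonneg_left h2 ha.le
  have h9 : (A + a) * ⟪g, w - z⟫_ℝ + a ^ 2 / 2 * ‖g‖ ^ 2 ≤ 0 := by
    have : (A + a) * ⟪g, w - z⟫_ℝ + a ^ 2 / 2 * ‖g‖ ^ 2 =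
        (A + a) / (2 * H) * (2 * H * ⟪g, w - z⟫_ℝ + ‖g‖ ^ 2 / 2) := by
      rw [hsq]
      field_simp
    rw [this]
    exact mul_nonpos_of_nonneg_of_nonpos (by positivity) h4
  rw [hA1, h3]
  linarith

/-- The probability that the Lyapunov function exceeds its initial value after `k` outer
iterations. -/
theorem SmoothConvex.toOuterMeasure_amRun_le {n : ℕ} [NeZero n]
    {f : EuclideanSpace ℝ (Fin n) → ℝ} {L : ℝ}
    {Lc : Fin n → ℝ} (hf : SmoothConvex f L Lc) (hH : 0 < H)
    {xs : EuclideanSpace ℝ (Fin n)} (hxs : ∀ y, f xs ≤ f y) (x₀ : EuclideanSpace ℝ (Fin n))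
    {δ : ℝ} (hδ : 0 < δ) {M N : ℕ} (hM : 0 < M) (hN : numInner H L Lc δ M ≤ N) (k : ℕ) :
    (amRun f H Lc (fun i => hf.add_pos hH i) x₀ N k).toOuterMeasure
      {s | ¬ amA H k * (f s.2 - f xs) + 1 / 2 * ‖s.1 - xs‖ ^ 2 ≤ 1 / 2 * ‖x₀ - xs‖ ^ 2} ≤
    k * ENNReal.ofReal (δ / M) := by
  induction k with
  | zero =>
    rw [amRun, PMF.toOuterMeasure_pure_apply]
    simp [amA]
  | succ k ih =>
    rw [amRun, Nat.cast_add, add_mul, Nat.cast_one, one_mul]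
    refine (PMF.toOuterMeasure_bind_le _ _ fun s hs => ?_).trans (add_le_add ih le_rfl)
    rw [PMF.toOuterMeasure_map_apply]
    refine le_trans (MeasureTheory.measure_mono fun v hv => ?_)
      (hf.toOuterMeasure_cdm_le (c := amProx H k s.1 s.2) hH hxs hδ hM hN)
    intro hgood
    exact hv ((hf.lyapunov_step hH k xs s.1 s.2 v hgood).trans (not_not.1 hs))

/-- The outer count gives M² ≥ (48/5)HR²/ε, whereas a gap of ε or more would force M²ε ≤ 4HR²; the
slack makes the inequality strict. -/
theorem SmoothConvex.amOutput_sub_lt {n : ℕ} [NeZero n] {f : EuclideanSpace ℝ (Fin n) → ℝ} {L : ℝ}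
    {Lc : Fin n → ℝ} (hf : SmoothConvex f L Lc) (x₀ xs : EuclideanSpace ℝ (Fin n))
    (hxs : ∀ y, f xs ≤ f y) (hH : 0 < H) {ε δ : ℝ} (hε : 0 < ε) (hδ : 0 < δ) {M N : ℕ}
    (hM : numOuter H ‖x₀ - xs‖ ε ≤ M) (hN : numInner H L Lc δ M ≤ N) :
    ENNReal.ofReal (1 - δ) ≤
      (amOutput f H Lc (fun i => hf.add_pos hH i) x₀ M N).toOuterMeasure
        {v | f v - f xs < ε} := by
  -- No outer iteration is allowed only when R = 0, and then the starting point is the minimizer.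
  rcases Nat.eq_zero_or_pos M with rfl | hM0
  · have h0 : x₀ = xs := by
      by_contra hne
      have hR : 0 < ‖x₀ - xs‖ := norm_pos_iff.2 (sub_ne_zero.2 hne)
      have : 0 < numOuter H ‖x₀ - xs‖ ε := Nat.ceil_pos.2 (by positivity)
      omega
    rw [amOutput, amRun, PMF.pure_map, PMF.toOuterMeasure_pure_apply]
    simp [h0, hε, hδ.le]
  have hM' : (0 : ℝ) < M := by exact_mod_cast hM0
  have h := hf.toOuterMeasure_amRun_le hH hxs x₀ hδ hM0 hN M
  have hδM : (M : ℝ≥0∞) * ENNReal.ofReal (δ / M) = ENNReal.ofReal δ := by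
    rw [← ENNReal.ofReal_natCast, ← ENNReal.ofReal_mul hM'.le, mul_div_cancel₀ _ hM'.ne']
  rw [hδM] at h
  have hsum := (amRun f H Lc (fun i => hf.add_pos hH i) x₀ N M).toOuterMeasure_compl_add
    (Prod.snd ⁻¹' {v | f v - f xs < ε})
  rw [amOutput, PMF.toOuterMeasure_map_apply, ENNReal.ofReal_sub _ hδ.le, ENNReal.ofReal_one,
    tsub_le_iff_right, ← hsum]
  refine add_le_add le_rfl (le_trans (MeasureTheory.measure_mono ?_) h)
  intro s hs hgood
  refine hs ?_
  change f s.2 - f xs < ε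
  have hA := le_amA hH M
  have hgap : 0 ≤ f s.2 - f xs := sub_nonneg.2 (hxs _)
  have hbound : (M : ℝ) ^ 2 / (8 * H) * (f s.2 - f xs) ≤ 1 / 2 * ‖x₀ - xs‖ ^ 2 := by
    have := mul_le_mul_of_nonneg_right hA hgap
    have := sq_nonneg ‖s.1 - xs‖
    linarith
  have hceil : 4 * Real.sqrt 15 / 5 * Real.sqrt (H * ‖x₀ - xs‖ ^ 2 / ε) ≤ M :=
    (Nat.le_ceil _).trans (by exact_mod_cast hM)
  have hsq : 48 / 5 * (H * ‖x₀ - xs‖ ^ 2 / ε) ≤ (M : ℝ) ^ 2 := by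
    have := pow_le_pow_left₀ (by positivity) hceil 2
    rw [mul_pow, div_pow, mul_pow, Real.sq_sqrt (by norm_num), Real.sq_sqrt (by positivity)] at this
    linarith
  by_contra hlt
  rw [not_lt] at hlt
  have h1 : 48 / 5 * (H * ‖x₀ - xs‖ ^ 2) ≤ (M : ℝ) ^ 2 * ε := by
    calc _ = 48 / 5 * (H * ‖x₀ - xs‖ ^ 2 / ε) * ε := by field_simp
      _ ≤ _ := by gcongr
  have h2 : (M : ℝ) ^ 2 * ε ≤ 4 * (H * ‖x₀ - xs‖ ^ 2) := by
    calc _ ≤ (M : ℝ) ^ 2 * (f s.2 - f xs) := by gcongr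
      _ = (M : ℝ) ^ 2 / (8 * H) * (f s.2 - f xs) * (8 * H) := by field_simp
      _ ≤ 1 / 2 * ‖x₀ - xs‖ ^ 2 * (8 * H) := by gcongr
      _ = _ := by ring
  have h3 : 0 < (M : ℝ) ^ 2 * ε := by positivity
  linarith

end Acceleration

/-! ### Iteration counts and the choice of H. -/

section Counting

variable {n : ℕ} {Lc : Fin n → ℝ} {H L R ε δ : ℝ}

theorem numOuter_eq (hH : 0 < H) (hR : 0 ≤ R) :
    numOuter H R ε = ⌈4 * Real.sqrt 15 / 5 * (R / Real.sqrt ε) * Real.sqrt H⌉₊ := by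
  rw [numOuter, Real.sqrt_div (by positivity), Real.sqrt_mul hH.le, Real.sqrt_sq hR]
  congr 1
  ring

theorem one_le_four_sqrt_fifteen_div_five : 1 ≤ 4 * Real.sqrt 15 / 5 := by
  have : (3 : ℝ) ≤ Real.sqrt 15 := Real.le_sqrt_of_sq_le (by norm_num)
  linarith

theorem four_sqrt_fifteen_div_five_le : 4 * Real.sqrt 15 / 5 ≤ 4 := by
  have : Real.sqrt 15 ≤ 4 := (Real.sqrt_le_left (by norm_num)).2 (by norm_num)
  linarith

theorem numTotal_zero_radius : numTotal H L Lc 0 ε δ = 0 := by simp [numTotal, numOuter]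

theorem numOuter_pos (hH : 0 < H) (hR : 0 < R) (hε : 0 < ε) : 1 ≤ numOuter H R ε := by
  have := one_le_four_sqrt_fifteen_div_five
  exact Nat.ceil_pos.2 (by positivity)

theorem one_le_log {x : ℝ} (hx : 9 ≤ x) : 1 ≤ Real.log x := by
  rw [Real.le_log_iff_exp_le (by linarith)]
  linarith [Real.exp_one_lt_d9]

theorem nine_le_condFactor (hH : 0 < H) (hL : 0 ≤ L) :
    9 ≤ (1 + L / H) * (3 + 2 * L / H) ^ 2 := by
  have h : 0 ≤ L / H := by positivity
  rw [mul_div_assoc]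
  nlinarith [mul_nonneg h h, mul_nonneg (mul_nonneg h h) h]

theorem coordSum_eq (hn : n ≠ 0) : coordSum H Lc = n * (H + meanLip Lc) := by
  have : (n : ℝ) ≠ 0 := by exact_mod_cast hn
  simp only [coordSum, meanLip, Finset.sum_add_distrib, Finset.sum_const, Finset.card_univ,
    Fintype.card_fin, nsmul_eq_mul]
  field_simp

theorem ne_zero_of_meanLip_pos (h : 0 < meanLip Lc) : n ≠ 0 := by
  rintro rfl
  simp [meanLip] at h

theorem numInner_le (hn : n ≠ 0) (hLc : ∀ i, 0 ≤ Lc i) (hH : 0 < H) (hL : 0 ≤ L) (hδ : 0 < δ)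
    (hδ1 : δ < 1) {M : ℕ} (hM : 1 ≤ M) :
    (numInner H L Lc δ M : ℝ) ≤ 2 * (coordSum H Lc / H *
      Real.log (M / δ * ((1 + L / H) * (3 + 2 * L / H) ^ 2))) := by
  have : NeZero n := ⟨hn⟩
  have hM' : (1 : ℝ) ≤ M := by exact_mod_cast hM
  have h1 : 1 ≤ coordSum H Lc / H := (one_le_div hH).2 (le_coordSum hLc hH)
  have h2 : 1 ≤ (M : ℝ) / δ := (one_le_div hδ).2 (by linarith)
  have h3 := nine_le_condFactor hH hL
  have h4 : 1 ≤ Real.log (M / δ * ((1 + L / H) * (3 + 2 * L / H) ^ 2)) :=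
    one_le_log (by nlinarith)
  have h5 := one_le_mul_of_one_le_of_one_le h1 h4
  rw [numInner, mul_assoc (M / δ : ℝ)]
  refine (Nat.ceil_lt_add_one (by linarith)).le.trans (by linarith)

theorem le_numInner (hn : n ≠ 0) (hl : 0 ≤ meanLip Lc) (hH : 0 < H) (hL : 0 ≤ L) (hδ : 0 < δ)
    {M : ℕ} (hM : 1 ≤ M) :
    n * (1 + meanLip Lc / H) * Real.log (9 * (M / δ)) ≤ (numInner H L Lc δ M : ℝ) := by
  have hM' : (1 : ℝ) ≤ M := by exact_mod_cast hM
  refine le_trans ?_ (Nat.le_ceil _)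
  have : coordSum H Lc / H = n * (1 + meanLip Lc / H) := by
    rw [coordSum_eq hn]
    field_simp
  rw [this, mul_assoc (M / δ : ℝ), mul_comm (9 : ℝ)]
  gcongr
  exact nine_le_condFactor hH hL

theorem le_numTotal (hn : n ≠ 0) (hl : 0 ≤ meanLip Lc) (hH : 0 < H) (hL : 0 ≤ L) (hδ : 0 < δ)
    (hR : 0 < R) (hε : 0 < ε) :
    numOuter H R ε * (n * (1 + meanLip Lc / H) * Real.log (9 * (numOuter H R ε / δ))) ≤
      (numTotal H L Lc R ε δ : ℝ) := by
  rw [numTotal, Nat.cast_mul]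
  gcongr
  exact le_numInner hn hl hH hL hδ (numOuter_pos hH hR hε)

theorem numTotal_meanLip_le (hLc : ∀ i, 0 ≤ Lc i) (hl : 0 < meanLip Lc) (hL : 0 ≤ L)
    (hδ : 0 < δ) (hδ1 : δ < 1) (hR : 0 < R) (hε : 0 < ε) :
    (numTotal (meanLip Lc) L Lc R ε δ : ℝ) ≤
      numOuter (meanLip Lc) R ε * (4 * n * Real.log (numOuter (meanLip Lc) R ε / δ *
        ((1 + L / meanLip Lc) * (3 + 2 * L / meanLip Lc) ^ 2))) := by
  have hn := ne_zero_of_meanLip_pos hl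
  rw [numTotal, Nat.cast_mul]
  gcongr
  refine (numInner_le hn hLc hl hL hδ hδ1 (numOuter_pos hl hR hε)).trans_eq ?_
  rw [coordSum_eq hn]
  field_simp
  ring

/-- The number of outer iterations grows at most like the square root of the regularization. -/
theorem numOuter_le_mul {l s : ℝ} (hH : 0 < H) (hl : 0 < l) (hR : 0 < R) (hε : 0 < ε)
    (hs1 : 1 ≤ s) (hs : Real.sqrt (l / H) ≤ s) :
    (numOuter l R ε : ℝ) ≤ 2 * s * numOuter H R ε := by
  have hM : (1 : ℝ) ≤ numOuter H R ε := by exact_mod_cast numOuter_pos hH hR hε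
  have h1 : (numOuter l R ε : ℝ) ≤ s * numOuter H R ε + 1 := by
    rw [numOuter_eq hl hR.le]
    refine (Nat.ceil_lt_add_one (by positivity)).le.trans (add_le_add ?_ le_rfl)
    have h2 : Real.sqrt l = Real.sqrt (l / H) * Real.sqrt H := by
      rw [← Real.sqrt_mul (by positivity), div_mul_cancel₀ _ hH.ne']
    calc _ = Real.sqrt (l / H) * (4 * Real.sqrt 15 / 5 * (R / Real.sqrt ε) * Real.sqrt H) := by
          rw [h2]; ring
      _ ≤ s * numOuter H R ε := by
          gcongr
          rw [numOuter_eq hH hR.le]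
          exact Nat.le_ceil _
  nlinarith

theorem numTotal_le_of_small :
    ∃ C : ℝ, 0 < C ∧ ∀ H L R : ℝ, 0 < H → 0 ≤ L → 0 ≤ R →
      ∃ ε₀ : ℝ, 0 < ε₀ ∧ ∀ (n : ℕ) (Lc : Fin n → ℝ), (∀ i, 0 ≤ Lc i) →
        ∀ ε δ : ℝ, 0 < ε → ε < ε₀ → 0 < δ → δ < 1 →
          (numTotal H L Lc R ε δ : ℝ) ≤
            C * (coordSum H Lc * R / Real.sqrt H * (1 / Real.sqrt ε) *
              Real.log (1 / (Real.sqrt ε * δ))) := by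
  refine ⟨32, by norm_num, fun H L R hH hL hR => ?_⟩
  rcases hR.eq_or_lt with rfl | hR
  · refine ⟨1, one_pos, fun n Lc _ ε δ _ _ _ _ => ?_⟩
    simp [numTotal_zero_radius]
  set K := (1 + L / H) * (3 + 2 * L / H) ^ 2 with hK
  have hK9 := nine_le_condFactor hH hL
  rw [← hK] at hK9
  have hKpos : 0 < K := by linarith
  set b := Real.sqrt H * R with hb
  have hbpos : 0 < b := by positivity
  -- The bound √ε < b lets the ceiling be absorbed into 8b/√ε; the bound √ε < 1/(8bK) lets the
  -- constants inside the logarithm be absorbed by doubling it.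
  refine ⟨min b (1 / (8 * b * K)) ^ 2, by positivity, fun n Lc hLc ε δ hε hεlt hδ hδ1 => ?_⟩
  rcases eq_or_ne n 0 with rfl | hn
  · simp [numTotal, numInner, coordSum]
  have hσ : Real.sqrt ε < min b (1 / (8 * b * K)) := (Real.sqrt_lt' (by positivity)).2 hεlt
  obtain ⟨hσ1, hσ2⟩ := lt_min_iff.1 hσ
  have hσpos : 0 < Real.sqrt ε := Real.sqrt_pos.2 hε
  set σ := Real.sqrt ε with hσdef
  set m := numOuter H R ε with hm
  have hm1 : 1 ≤ m := numOuter_pos hH hR hε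
  have hq : 1 ≤ b / σ := (one_le_div hσpos).2 hσ1.le
  have hmle : (m : ℝ) ≤ 8 * (b / σ) := by
    rw [hm, numOuter_eq hH hR.le]
    refine (Nat.ceil_lt_add_one (by positivity)).le.trans ?_
    have : 4 * Real.sqrt 15 / 5 * (R / Real.sqrt ε) * Real.sqrt H =
        4 * Real.sqrt 15 / 5 * (b / σ) := by rw [hb, ← hσdef]; ring
    rw [this]
    nlinarith [four_sqrt_fifteen_div_five_le]
  have hm' : (1 : ℝ) ≤ m := by exact_mod_cast hm1
  have hlog : Real.log (m / δ * K) ≤ 2 * Real.log (1 / (σ * δ)) := by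
    rw [← Real.log_rpow (by positivity), Real.rpow_two]
    refine Real.log_le_log (by positivity) ?_
    have h1 : 8 * b * K ≤ 1 / σ := by
      rw [le_div_iff₀ hσpos, mul_comm]
      exact ((lt_div_iff₀ (by positivity)).1 hσ2).le
    calc m / δ * K ≤ 8 * (b / σ) / δ * K := by gcongr
      _ = 8 * b * K * (1 / (σ * δ)) := by field_simp
      _ ≤ 1 / σ * (1 / (σ * δ)) := by gcongr
      _ ≤ 1 / (σ * δ) * (1 / (σ * δ)) := by
          gcongr
          exact mul_le_of_le_one_right hσpos.le hδ1.le
      _ = _ := by ring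
  have : NeZero n := ⟨hn⟩
  have hZ : 0 < coordSum H Lc := hH.trans_le (le_coordSum hLc hH)
  have hX : 0 ≤ Real.log (1 / (σ * δ)) := by
    have : 1 ≤ (m : ℝ) / δ := (one_le_div hδ).2 (by linarith)
    have := one_le_log (x := m / δ * K) (by nlinarith)
    linarith
  rw [numTotal, Nat.cast_mul]
  calc _ ≤ (8 * (b / σ)) * (2 * (coordSum H Lc / H * (2 * Real.log (1 / (σ * δ))))) := by
        refine mul_le_mul hmle ?_ (by positivity) (by positivity)
        refine (numInner_le hn hLc hH hL hδ hδ1 hm1).trans ?_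
        gcongr
    _ = 32 * (coordSum H Lc * R * (Real.sqrt H / H) * (1 / σ) * Real.log (1 / (σ * δ))) := by
        rw [hb]; ring
    _ = _ := by rw [Real.sqrt_div_self]; ring

/-- With l the mean, Z/√H = n(√H + l/√H), so this is strict AM-GM: (√H - √l)² > 0. -/
theorem coordSum_meanLip_div_sqrt_lt (hl : 0 < meanLip Lc) (hH : 0 < H) (hne : H ≠ meanLip Lc) :
    coordSum (meanLip Lc) Lc / Real.sqrt (meanLip Lc) < coordSum H Lc / Real.sqrt H := by
  have hn := ne_zero_of_meanLip_pos hl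
  have hn' : (0 : ℝ) < n := by exact_mod_cast Nat.pos_of_ne_zero hn
  rw [coordSum_eq hn, coordSum_eq hn]
  have h1 := Real.sqrt_pos.2 hl
  have h2 := Real.sqrt_pos.2 hH
  have h3 := Real.sq_sqrt hl.le
  have h4 := Real.sq_sqrt hH.le
  set l := meanLip Lc
  have hne' : Real.sqrt H - Real.sqrt l ≠ 0 :=
    sub_ne_zero.2 fun h => hne ((Real.sqrt_inj hH.le hl.le).1 h)
  rw [div_lt_div_iff₀ h1 h2, mul_assoc, mul_assoc]
  refine mul_lt_mul_of_pos_left ?_ hn'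
  have := mul_pos h1 (sq_pos_of_ne_zero hne')
  calc (l + l) * Real.sqrt H = Real.sqrt l * (2 * Real.sqrt l * Real.sqrt H) := by
        nth_rewrite 1 2 [← h3]; ring
    _ < Real.sqrt l * (Real.sqrt H ^ 2 + Real.sqrt l ^ 2) := by nlinarith
    _ = _ := by rw [h3, h4]; ring

theorem log_nine_mul_le {x y t δ : ℝ} (hδ : 0 < δ) (hx : 0 < x) (hy : 0 < y) (ht : 0 < t)
    (h : x ≤ t * y) :
    Real.log (9 * (x / δ)) ≤ Real.log (9 * (y / δ)) + Real.log t := by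
  rw [← Real.log_mul (by positivity) (by positivity)]
  refine Real.log_le_log (by positivity) ?_
  calc 9 * (x / δ) ≤ 9 * (t * y / δ) := by gcongr
    _ = _ := by ring

/-- Passing from l to H costs at most 2s in the outer count and 2s in the logarithm, with s = max(1,
√(l/H)). The product 4s² is paid for by the factor 1 + l/H in the inner count for H. -/
theorem numTotal_meanLip_le_mul_numTotal :
    ∃ C : ℝ, 0 < C ∧ ∀ (n : ℕ) (L : ℝ) (Lc : Fin n → ℝ), 0 ≤ L → (∀ i, 0 ≤ Lc i) →
      0 < meanLip Lc → ∀ R ε δ : ℝ, 0 ≤ R → 0 < ε → 0 < δ → δ < 1 → ∀ H : ℝ, 0 < H →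
        (numTotal (meanLip Lc) L Lc R ε δ : ℝ) ≤
          C * (1 + Real.log (1 + L / meanLip Lc)) * numTotal H L Lc R ε δ := by
  refine ⟨48, by norm_num, fun n L Lc hL hLc hl R ε δ hR hε hδ hδ1 H hH => ?_⟩
  rcases hR.eq_or_lt with rfl | hR
  · simp [numTotal_zero_radius]
  have hn := ne_zero_of_meanLip_pos hl
  have hup := numTotal_meanLip_le hLc hl hL hδ hδ1 hR hε
  have hlow := le_numTotal hn hl.le hH hL hδ hR hε
  set l := meanLip Lc
  set s := max 1 (Real.sqrt (l / H)) with hs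
  have hs1 : 1 ≤ s := le_max_left _ _
  have hs2 : s ^ 2 ≤ 1 + l / H := by
    have : 0 < l / H := by positivity
    rcases max_choice 1 (Real.sqrt (l / H)) with h | h
    · rw [hs, h]; linarith
    · rw [hs, h, Real.sq_sqrt this.le]; linarith
  have hmM := numOuter_le_mul hH hl hR hε hs1 (le_max_right _ _)
  have hm1 : (1 : ℝ) ≤ numOuter l R ε := by exact_mod_cast numOuter_pos hl hR hε
  have hM1 : (1 : ℝ) ≤ numOuter H R ε := by exact_mod_cast numOuter_pos hH hR hε
  set m : ℝ := (numOuter l R ε : ℝ)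
  set M : ℝ := (numOuter H R ε : ℝ)
  set Λ := Real.log (9 * (M / δ)) with hΛ
  set X := Real.log (9 * (m / δ)) with hX
  have hΛ1 : 1 ≤ Λ := one_le_log (by linarith [(one_le_div hδ).2 (hδ1.le.trans hM1)])
  have hX1 : 1 ≤ X := one_le_log (by linarith [(one_le_div hδ).2 (hδ1.le.trans hm1)])
  -- This is Λ + (2s - 1) ≤ 2sΛ, that is (2s - 1)(Λ - 1) ≥ 0.
  have hXΛ : X ≤ 2 * s * Λ := by
    have h1 := log_nine_mul_le hδ (by linarith) (by linarith) (by linarith) hmM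
    have h2 := Real.log_le_sub_one_of_pos (show 0 < 2 * s by linarith)
    nlinarith
  set r := L / l with hr
  have hr0 : 0 ≤ r := by positivity
  set ℓ := Real.log (1 + r)
  have hℓ : 0 ≤ ℓ := Real.log_nonneg (by linarith)
  have hlog : Real.log (m / δ * ((1 + r) * (3 + 2 * L / l) ^ 2)) ≤ X * (1 + 3 * ℓ) := by
    have h1 : m / δ * ((1 + r) * (3 + 2 * L / l) ^ 2) ≤ 9 * (m / δ) * (1 + r) ^ 3 := by
      rw [mul_div_assoc, ← hr]
      calc _ ≤ m / δ * ((1 + r) * (3 * (1 + r)) ^ 2) := by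
            gcongr
            linarith
        _ = _ := by ring
    calc _ ≤ Real.log (9 * (m / δ) * (1 + r) ^ 3) :=
          Real.log_le_log (by positivity) h1
      _ = X + 3 * ℓ := by
          rw [Real.log_mul (by positivity) (by positivity), Real.log_pow]
          norm_num [hX, ℓ]
      _ ≤ _ := by nlinarith
  calc _ ≤ m * (4 * n * (X * (1 + 3 * ℓ))) := by
        refine hup.trans ?_
        gcongr
    _ ≤ 2 * s * M * (4 * n * (2 * s * Λ * (1 + 3 * ℓ))) := by gcongr
    _ = 16 * (1 + 3 * ℓ) * (M * (n * s ^ 2 * Λ)) := by ring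
    _ ≤ 16 * (1 + 3 * ℓ) * (M * (n * (1 + l / H) * Λ)) := by gcongr
    _ ≤ 16 * (3 * (1 + ℓ)) * numTotal H L Lc R ε δ := by
        gcongr
        linarith
    _ = _ := by ring

/-- Bound the logarithm by its tangent at s = 64, where 2s = 2⁷. -/
theorem le_of_le_one_add_log {s : ℝ} (hs : 0 < s) (h : s ≤ 16 * (1 + Real.log (2 * s))) :
    s ≤ 104 := by
  have h1 : Real.log (2 * s) = Real.log (s / 64) + 7 * Real.log 2 := by
    rw [show (7 : ℝ) = (7 : ℕ) by norm_num, ← Real.log_pow,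
      ← Real.log_mul (by positivity) (by positivity)]
    congr 1
    ring
  have h2 := Real.log_le_sub_one_of_pos (show 0 < s / 64 by positivity)
  have h3 := Real.log_two_lt_d9
  linarith

theorem comparable_of_numTotal_le :
    ∃ C : ℝ, 0 < C ∧ ∀ L l R : ℝ, 0 ≤ L → 0 < l → 0 < R →
      ∃ ε₀ : ℝ, 0 < ε₀ ∧ ∀ (n : ℕ) (Lc : Fin n → ℝ), (∀ i, 0 ≤ Lc i) → meanLip Lc = l →
        ∀ ε δ : ℝ, 0 < ε → ε < ε₀ → 0 < δ → δ < 1 → ∀ H : ℝ, 0 < H →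
          numTotal H L Lc R ε δ ≤ numTotal (meanLip Lc) L Lc R ε δ →
            meanLip Lc / C ≤ H ∧ H ≤ C * meanLip Lc := by
  -- 10816 = 104², from the case H ≤ l; the case l ≤ H only needs 16² = 256.
  refine ⟨10816, by norm_num, fun L l R hL hl hR => ?_⟩
  set K := (1 + L / l) * (3 + 2 * L / l) ^ 2 with hK
  have hK9 := nine_le_condFactor hl hL
  rw [← hK] at hK9
  have hKpos : 0 < K := by linarith
  -- For such ε the outer count at l is at least K, so K at most doubles the logarithm.
  refine ⟨(R * Real.sqrt l / K) ^ 2, by positivity, ?_⟩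
  intro n Lc hLc hmean ε δ hε hεlt hδ hδ1 H hH hle
  have hn := ne_zero_of_meanLip_pos (hmean ▸ hl : 0 < meanLip Lc)
  have hn' : (0 : ℝ) < n := by exact_mod_cast Nat.pos_of_ne_zero hn
  have hup := numTotal_meanLip_le hLc (hmean ▸ hl) hL hδ hδ1 hR hε
  have hlow := le_numTotal hn (hmean ▸ hl.le) hH hL hδ hR hε
  have hle' : (numTotal H L Lc R ε δ : ℝ) ≤ numTotal (meanLip Lc) L Lc R ε δ := by
    exact_mod_cast hle
  have hchain := hlow.trans (hle'.trans hup)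
  rw [hmean, ← hK] at hchain
  rw [hmean]
  have hm1 : (1 : ℝ) ≤ numOuter l R ε := by exact_mod_cast numOuter_pos hl hR hε
  have hM1 : (1 : ℝ) ≤ numOuter H R ε := by exact_mod_cast numOuter_pos hH hR hε
  have hσ : Real.sqrt ε < R * Real.sqrt l / K := (Real.sqrt_lt' (by positivity)).2 hεlt
  have hσpos : 0 < Real.sqrt ε := Real.sqrt_pos.2 hε
  set q := 4 * Real.sqrt 15 / 5 * (R / Real.sqrt ε) with hq
  have hqK : K ≤ q * Real.sqrt l := by
    have h1 : K ≤ R / Real.sqrt ε * Real.sqrt l := by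
      rw [div_mul_eq_mul_div, le_div_iff₀ hσpos, mul_comm]
      exact ((lt_div_iff₀ hKpos).1 hσ).le
    have h2 : 0 ≤ R / Real.sqrt ε * Real.sqrt l := by positivity
    rw [hq, mul_assoc]
    exact h1.trans (le_mul_of_one_le_left h2 one_le_four_sqrt_fifteen_div_five)
  have hmq : q * Real.sqrt l ≤ numOuter l R ε := by
    rw [numOuter_eq hl hR.le]
    exact Nat.le_ceil _
  have hMq : q * Real.sqrt H ≤ numOuter H R ε := by
    rw [numOuter_eq hH hR.le]
    exact Nat.le_ceil _
  have hmq2 : (numOuter l R ε : ℝ) ≤ 2 * (q * Real.sqrt l) := by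
    rw [numOuter_eq hl hR.le]
    refine (Nat.ceil_lt_add_one (by positivity)).le.trans ?_
    rw [← hq]
    linarith
  have hMmono : l ≤ H → (numOuter l R ε : ℝ) ≤ numOuter H R ε := by
    intro h
    rw [numOuter_eq hl hR.le, numOuter_eq hH hR.le]
    gcongr
  have hmM : H ≤ l → (numOuter l R ε : ℝ) ≤ 2 * Real.sqrt (l / H) * numOuter H R ε := fun h =>
    numOuter_le_mul hH hl hR hε (Real.one_le_sqrt.2 ((one_le_div hH).2 h)) le_rfl
  set m : ℝ := (numOuter l R ε : ℝ)
  set M : ℝ := (numOuter H R ε : ℝ)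
  set Λ := Real.log (9 * (M / δ)) with hΛ
  set X := Real.log (9 * (m / δ)) with hX
  have hmδ : m ≤ m / δ := le_div_self (by linarith) hδ hδ1.le
  have hΛ1 : 1 ≤ Λ := one_le_log (by linarith [(one_le_div hδ).2 (hδ1.le.trans hM1)])
  have hX1 : 1 ≤ X := one_le_log (by linarith)
  have hlog : Real.log (m / δ * K) ≤ 2 * X := by
    rw [hX, ← Real.log_rpow (by positivity), Real.rpow_two]
    refine Real.log_le_log (by positivity) ?_
    rw [sq]
    gcongr <;> linarith
  have hmain : M * (1 + l / H) * Λ ≤ 8 * (m * X) := by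
    refine le_of_mul_le_mul_left ?_ hn'
    calc _ = M * (n * (1 + l / H) * Λ) := by ring
      _ ≤ m * (4 * n * (2 * X)) := by
          refine hchain.trans ?_
          gcongr
      _ = _ := by ring
  -- For H ≥ l the logarithm at H is the larger one, so `hmain` bounds M by 8m, and the counts scale
  -- like square roots. For H ≤ l, `hmain` only gives s ≤ 16(1 + log(2s)) with s = √(l/H), which
  -- still bounds s.
  rcases le_total l H with hlH | hHl
  · refine ⟨by linarith, ?_⟩
    have h1 : m * Real.sqrt H ≤ 2 * M * Real.sqrt l := by
      calc _ ≤ 2 * (q * Real.sqrt l) * Real.sqrt H := by gcongr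
        _ = 2 * (q * Real.sqrt H) * Real.sqrt l := by ring
        _ ≤ _ := by gcongr
    have h2 : X ≤ Λ := Real.log_le_log (by positivity) (by gcongr; exact hMmono hlH)
    have h3 : M ≤ 8 * m := by
      refine le_of_mul_le_mul_right (a := X) ?_ (by linarith)
      calc M * X ≤ M * (1 + l / H) * Λ := by
            gcongr
            exact le_mul_of_one_le_right (by linarith)
              (le_add_of_nonneg_right (by positivity))
        _ ≤ _ := hmain.trans_eq (by ring)
    have h4 : Real.sqrt H ≤ 16 * Real.sqrt l := by
      refine le_of_mul_le_mul_left (a := m) ?_ (by linarith)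
      calc _ ≤ 2 * M * Real.sqrt l := h1
        _ ≤ 2 * (8 * m) * Real.sqrt l := by gcongr
        _ = _ := by ring
    have h5 := pow_le_pow_left₀ (Real.sqrt_nonneg H) h4 2
    rw [mul_pow, Real.sq_sqrt hH.le, Real.sq_sqrt hl.le] at h5
    linarith
  · refine ⟨?_, by linarith⟩
    have hs1 : 1 ≤ Real.sqrt (l / H) := Real.one_le_sqrt.2 ((one_le_div hH).2 hHl)
    have hs2 : Real.sqrt (l / H) ^ 2 = l / H := Real.sq_sqrt (by positivity)
    have hmM' := hmM hHl
    rw [← hs2] at hmain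
    have hXΛ := log_nine_mul_le hδ (by linarith) (by linarith) (by linarith) hmM'
    set s := Real.sqrt (l / H)
    have hls : 0 ≤ Real.log (2 * s) := Real.log_nonneg (by linarith)
    have h1 : s ≤ 16 * (1 + Real.log (2 * s)) := by
      refine le_of_mul_le_mul_left (a := m * Λ) ?_ (by positivity)
      calc m * Λ * s ≤ 2 * s * M * Λ * s := by gcongr
        _ = 2 * (M * s ^ 2 * Λ) := by ring
        _ ≤ 2 * (M * (1 + s ^ 2) * Λ) := by
            gcongr
            linarith
        _ ≤ 2 * (8 * (m * X)) := by gcongr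
        _ ≤ 2 * (8 * (m * (Λ * (1 + Real.log (2 * s))))) := by
            gcongr
            nlinarith
        _ = _ := by ring
    have h2 := pow_le_pow_left₀ (by linarith) (le_of_le_one_add_log (by linarith) h1) 2
    rw [hs2, div_le_iff₀ hH] at h2
    linarith

end Counting

theorem corollary2 :
    -- Sufficiency: the output is `ε`-optimal with probability at least `1 - δ`.
    (∀ (n : ℕ) [NeZero n] (f : EuclideanSpace ℝ (Fin n) → ℝ) (L : ℝ) (Lc : Fin n → ℝ)
      (hf : SmoothConvex f L Lc) (x₀ xs : EuclideanSpace ℝ (Fin n)) (_ : ∀ y, f xs ≤ f y)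
      (H : ℝ) (hH : 0 < H) (ε δ : ℝ), 0 < ε → 0 < δ → δ < 1 →
      ∀ M N : ℕ, numOuter H ‖x₀ - xs‖ ε ≤ M → numInner H L Lc δ M ≤ N →
        ENNReal.ofReal (1 - δ) ≤
          (amOutput f H Lc (fun i => hf.add_pos hH i) x₀ M N).toOuterMeasure
            {v | f v - f xs < ε}) ∧
    -- The total number of iterations is `O((Z R / √H) ε^(-1/2) log(1 / (ε^(1/2) δ)))`.
    (∃ C : ℝ, 0 < C ∧ ∀ H L R : ℝ, 0 < H → 0 ≤ L → 0 ≤ R →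
      ∃ ε₀ : ℝ, 0 < ε₀ ∧ ∀ (n : ℕ) (Lc : Fin n → ℝ), (∀ i, 0 ≤ Lc i) →
        ∀ ε δ : ℝ, 0 < ε → ε < ε₀ → 0 < δ → δ < 1 →
          (numTotal H L Lc R ε δ : ℝ) ≤
            C * (coordSum H Lc * R / Real.sqrt H * (1 / Real.sqrt ε) *
              Real.log (1 / (Real.sqrt ε * δ)))) ∧
    -- The factor `Z / √H` of this bound has the mean of the `Lᵢ` as its unique minimizer.
    (∀ (n : ℕ) (Lc : Fin n → ℝ), (∀ i, 0 ≤ Lc i) → 0 < meanLip Lc →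
      ∀ H : ℝ, 0 < H → H ≠ meanLip Lc →
        coordSum (meanLip Lc) Lc / Real.sqrt (meanLip Lc) < coordSum H Lc / Real.sqrt H) ∧
    -- Up to a logarithmic factor, no `H` gives fewer iterations than the mean of the `Lᵢ`.
    (∃ C : ℝ, 0 < C ∧ ∀ (n : ℕ) (L : ℝ) (Lc : Fin n → ℝ), 0 ≤ L → (∀ i, 0 ≤ Lc i) →
      0 < meanLip Lc → ∀ R ε δ : ℝ, 0 ≤ R → 0 < ε → 0 < δ → δ < 1 → ∀ H : ℝ, 0 < H →
        (numTotal (meanLip Lc) L Lc R ε δ : ℝ) ≤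
          C * (1 + Real.log (1 + L / meanLip Lc)) * numTotal H L Lc R ε δ) ∧
    -- For small `ε`, every `H` that does at least as well is comparable with that mean.
    (∃ C : ℝ, 0 < C ∧ ∀ L l R : ℝ, 0 ≤ L → 0 < l → 0 < R →
      ∃ ε₀ : ℝ, 0 < ε₀ ∧ ∀ (n : ℕ) (Lc : Fin n → ℝ), (∀ i, 0 ≤ Lc i) → meanLip Lc = l →
        ∀ ε δ : ℝ, 0 < ε → ε < ε₀ → 0 < δ → δ < 1 → ∀ H : ℝ, 0 < H →
          numTotal H L Lc R ε δ ≤ numTotal (meanLip Lc) L Lc R ε δ →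
            meanLip Lc / C ≤ H ∧ H ≤ C * meanLip Lc) :=
  ⟨fun _ _ _ _ _ hf x₀ xs hxs _ hH _ _ hε hδ _ _ _ hM hN =>
      hf.amOutput_sub_lt x₀ xs hxs hH hε hδ hM hN,
    numTotal_le_of_small,
    fun _ _ _ hl _ hH hne => coordSum_meanLip_div_sqrt_lt hl hH hne,
    numTotal_meanLip_le_mul_numTotal,
    comparable_of_numTotal_le⟩
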